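/- Let $C$ be a quantum circuit on a finite set $V$ of qubits, given as a finite sequence of single-qubit and two-qubit operations. Its connectivity graph has vertex set $V$ and an edge between two distinct qubits whenever some two-qubit operation of $C$ acts on them. For an integer $l\ge 0$, an $l$-planar layout consists of a placement of the qubits at distinct points of the grid $\mathbb{Z}^2\subset\mathbb{R}^2$ and of $l$ graphs (layers) on $V$ with pairwise disjoint edge sets, such that each layer is drawn in the plane without crossings with every qubit at its given point: edges are simple arcs joining their endpoints, no edge passes through another qubit, and two edges of the same layer meet only at common endpoints. So every qubit has the same position in all layers. The layout implements $C$ if every two-qubit operation of $C$ acts on a pair of qubits joined by an edge of some layer. Suppose that the connectivity graph of $C$ has maximum degree at most $\delta$. Then $C$ can be implemented with a $\lceil \delta/2\rceil$-planar layout. More precisely, the thickness of the connectivity graph (the least number of planar subgraphs into which its edges can be partitioned) is at most $\lceil\delta/2\rceil$, and for every placement of the qubits at distinct points of $\mathbb{Z}^2$ there is a $\lceil\delta/2\rceil$-planar layout with this placement that implements $C$ and whose layers partition the edges of the connectivity graph. -/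

import Mathlib

open scoped Matrix

/-- A physical operation on `k` qubits (unitary gate, preparation, measurement, channel, ...): a
quantum instrument with finitely many classical outcomes, where outcome `i` is given by the Kraus
operators `kraus i j` and the total map is trace preserving. -/
structure QuantumInstrument (k : ℕ) where
  outcomes : ℕ
  rank : ℕ
  kraus : Fin outcomes → Fin rank → Matrix (Fin k → Fin 2) (Fin k → Fin 2) ℂ
  complete : ∑ i, ∑ j, (kraus i j)ᴴ * kraus i j = 1

/-- One step of a circuit on the qubits `V`: a single-qubit or a two-qubit operation. The
instrument may depend on the list of earlier measurement outcomes (classical feed-forward). -/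
inductive CircuitOperation (V : Type*) where
  | single (q : V) (instr : List ℕ → QuantumInstrument 1) : CircuitOperation V
  | double (q r : V) (hne : q ≠ r) (instr : List ℕ → QuantumInstrument 2) : CircuitOperation V

/-- `o` is a two-qubit operation acting on the pair `{a, b}`. -/
def CircuitOperation.Couples {V : Type*} : CircuitOperation V → V → V → Prop
  | .single _ _, _, _ => False
  | .double q r _ _, a, b => s(a, b) = s(q, r)

/-- A circuit of single- and two-qubit operations, in order of execution. -/
abbrev QuantumCircuit (V : Type*) := List (CircuitOperation V)

/-- The connectivity graph: two qubits are adjacent iff some two-qubit operation acts on them. -/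
def QuantumCircuit.connectivityGraph {V : Type*} (C : QuantumCircuit V) : SimpleGraph V where
  Adj a b := ∃ o ∈ C, o.Couples a b
  symm := ⟨by
    rintro a b ⟨o, ho, h⟩
    refine ⟨o, ho, ?_⟩
    cases o with
    | single q f => exact h
    | double q r hne f => exact Sym2.eq_swap.trans h⟩
  loopless := ⟨by
    rintro a ⟨o, -, h⟩
    cases o with
    | single q f => exact h
    | double q r hne f =>
      rcases Sym2.eq_iff.1 h with ⟨h1, h2⟩ | ⟨h1, h2⟩
      · exact hne (h1.symm.trans h2)
      · exact hne (h2.symm.trans h1)⟩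

/-- A crossing-free drawing of `G` in the plane with vertex `v` at the point `pos v`: edges are
simple arcs joining their endpoints, contain no other vertex, and two distinct edges meet only at
common endpoints. -/
structure PlaneDrawing {V : Type*} (G : SimpleGraph V) (pos : V → ℝ × ℝ) where
  curve : G.edgeSet → C(unitInterval, ℝ × ℝ)
  pos_injective : Function.Injective pos
  curve_injective : ∀ e, Function.Injective (curve e)
  curve_ends : ∀ e : G.edgeSet, s(curve e 0, curve e 1) = (e : Sym2 V).map pos
  avoids_vertices : ∀ (e : G.edgeSet) (t : unitInterval) (v : V),
    curve e t = pos v → v ∈ (e : Sym2 V)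
  no_crossing : ∀ e f : G.edgeSet, e ≠ f → ∀ s t : unitInterval, curve e s = curve f t →
    ∃ v : V, v ∈ (e : Sym2 V) ∧ v ∈ (f : Sym2 V) ∧ curve e s = pos v

/-- A graph is planar if it has a crossing-free drawing in the plane. -/
def SimpleGraph.IsPlanarGraph {V : Type*} (G : SimpleGraph V) : Prop :=
  ∃ pos : V → ℝ × ℝ, Nonempty (PlaneDrawing G pos)

/-- `layer` partitions the edges of `G`. -/
def IsEdgePartition {V : Type*} {l : ℕ} (G : SimpleGraph V) (layer : Fin l → SimpleGraph V) :
    Prop :=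
  (⨆ i, layer i) = G ∧ Pairwise fun i j => Disjoint (layer i) (layer j)

/-- The thickness: the least number of planar subgraphs into which the edges of `G` can be
partitioned (`⊤` if there is no such finite partition). -/
noncomputable def SimpleGraph.thickness {V : Type*} (G : SimpleGraph V) : ℕ∞ :=
  sInf {n : ℕ∞ | ∃ (l : ℕ) (layer : Fin l → SimpleGraph V), n = l ∧
    IsEdgePartition G layer ∧ ∀ i, (layer i).IsPlanarGraph}

/-- The point of the plane at a site of the 2D square grid. -/
def gridPoint (p : ℤ × ℤ) : ℝ × ℝ := ((p.1 : ℝ), (p.2 : ℝ))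

/-- An `l`-planar layout: qubits placed at distinct sites of the 2D grid, with connections separated
into `l` layers, each drawn without crossings. The position of a qubit is the same in all layers. -/
structure PlanarLayout (V : Type*) (l : ℕ) where
  position : V ↪ ℤ × ℤ
  layer : Fin l → SimpleGraph V
  layer_disjoint : Pairwise fun i j => Disjoint (layer i) (layer j)
  drawing : ∀ i, PlaneDrawing (layer i) fun v => gridPoint (position v)

/-- All the connections available in a layout. -/
def PlanarLayout.connections {V : Type*} {l : ℕ} (L : PlanarLayout V l) : SimpleGraph V :=
  ⨆ i, L.layer i

/-- The circuit `C` can be executed on the layout `L`: every two-qubit operation of `C` acts along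
a connection of some layer. -/
def PlanarLayout.Implements {V : Type*} {l : ℕ} (L : PlanarLayout V l) (C : QuantumCircuit V) :
    Prop :=
  ∀ o ∈ C, ∀ a b : V, o.Couples a b → ∃ i, (L.layer i).Adj a b

/-! This is Petersen's 2-factor argument followed by a one-page book embedding. With k = ⌈δ/2⌉, pad
the graph to a 2k-regular multigraph and orient it with all in- and out-degrees k. Reading sources
and targets as two sides gives a k-regular bipartite multigraph, which splits into k perfect
matchings. Each matching, restricted to the original edges, is a partial injection of the vertices,
so a layer is a disjoint union of paths and cycles.

Numbering vertices consecutively along cycles makes edges non-interleaving, so arcs above a line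
draw the layer without crossings. A homeomorphism of the plane carries the points on the line to any
prescribed distinct points. Hence the layers do not depend on the placement. -/

/-! ### Balanced orientations and bipartite edge colouring -/

/-- A multigraph in which every vertex has degree `2 * k` has an orientation in which all in- and
out-degrees are `k`. -/
theorem exists_balanced_orientation {E W : Type*} [Fintype E] [Fintype W] [DecidableEq E]
    [DecidableEq W] (k : ℕ) (a b : E → W)
    (h : ∀ w, (Finset.univ.filter fun e => a e = w).card +
      (Finset.univ.filter fun e => b e = w).card = 2 * k) :
    ∃ src tgt : E → W,
      (∀ e, (src e = a e ∧ tgt e = b e) ∨ (src e = b e ∧ tgt e = a e)) ∧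
      (∀ w, (Finset.univ.filter fun e => src e = w).card = k) ∧
      ∀ w, (Finset.univ.filter fun e => tgt e = w).card = k := by
  -- Hall's condition for giving each edge one of `k` slots at one of its ends, which becomes its
  -- source. Double counting ends bounds `2 * S.card` by `2 * k` times the number of vertices
  -- touched.
  have hall : ∀ S : Finset E, S.card ≤
      (S.biUnion fun e => ({a e, b e} : Finset W) ×ˢ (Finset.univ : Finset (Fin k))).card := by
    intro S
    set U : Finset W := S.biUnion fun e => {a e, b e} with hU
    have hprod : (S.biUnion fun e => ({a e, b e} : Finset W) ×ˢ (Finset.univ : Finset (Fin k)))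
        = U ×ˢ Finset.univ := by
      ext ⟨w, i⟩
      simp [hU]
    rw [hprod, Finset.card_product, Finset.card_univ, Fintype.card_fin]
    have ha : S.card = ∑ w ∈ U, (S.filter fun e => a e = w).card :=
      Finset.card_eq_sum_card_fiberwise fun e he => by
        simp only [hU, Finset.coe_biUnion, Set.mem_iUnion]
        exact ⟨e, he, by simp⟩
    have hb : S.card = ∑ w ∈ U, (S.filter fun e => b e = w).card :=
      Finset.card_eq_sum_card_fiberwise fun e he => by
        simp only [hU, Finset.coe_biUnion, Set.mem_iUnion]
        exact ⟨e, he, by simp⟩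
    have hle : S.card + S.card ≤ U.card * (2 * k) := by
      conv_lhs => rw [ha]
      nth_rewrite 2 [← ha]
      rw [hb, ← Finset.sum_add_distrib, ← smul_eq_mul]
      refine Finset.sum_le_card_nsmul _ _ _ fun w _ => ?_
      rw [← h w]
      exact add_le_add (Finset.card_le_card (Finset.filter_subset_filter _ (Finset.subset_univ _)))
        (Finset.card_le_card (Finset.filter_subset_filter _ (Finset.subset_univ _)))
    linarith
  obtain ⟨f, hf, hfm⟩ := (Finset.all_card_le_biUnion_card_iff_exists_injective _).1 hall
  have hmem : ∀ e, (f e).1 = a e ∨ (f e).1 = b e := fun e => by simpa using hfm e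
  have hsrc_le : ∀ w, (Finset.univ.filter fun e => (f e).1 = w).card ≤ k := by
    intro w
    have := Finset.card_le_card_of_injOn (s := Finset.univ.filter fun e => (f e).1 = w)
      (t := (Finset.univ : Finset (Fin k))) (fun e => (f e).2) (fun _ _ => Finset.mem_univ _)
      (fun e he e' he' hee => hf (Prod.ext (by
        simp only [Finset.coe_filter, Finset.mem_univ, true_and, Set.mem_ofPred_eq] at he he'
        rw [he, he']) hee))
    simpa using this
  have total : ∀ g : E → W,
      Fintype.card E = ∑ w, (Finset.univ.filter fun e => g e = w).card := fun g =>
    Finset.card_eq_sum_card_fiberwise fun _ _ => by simp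
  -- There are exactly as many edges as slots, so the bound `k` on each out-degree is attained.
  have hE : Fintype.card E = ∑ _w : W, k := by
    have h2 : 2 * Fintype.card E = 2 * ∑ _w : W, k := by
      rw [two_mul]
      nth_rewrite 1 [total a]
      rw [total b, ← Finset.sum_add_distrib, Finset.mul_sum]
      exact Finset.sum_congr rfl fun w _ => h w
    omega
  have hsrc : ∀ w, (Finset.univ.filter fun e => (f e).1 = w).card = k := fun w =>
    (Finset.sum_eq_sum_iff_of_le fun w _ => hsrc_le w).1
      ((total fun e => (f e).1).symm.trans hE) w (Finset.mem_univ w)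
  refine ⟨fun e => (f e).1, fun e => if (f e).1 = a e then b e else a e, fun e => ?_, hsrc,
    fun w => ?_⟩
  · by_cases he : (f e).1 = a e
    · simp [he]
    · simp [(hmem e).resolve_left he]
  · have key : (Finset.univ.filter fun e => (f e).1 = w).card +
        (Finset.univ.filter fun e => (if (f e).1 = a e then b e else a e) = w).card = 2 * k := by
      rw [← h w]
      simp only [Finset.card_filter, ← Finset.sum_add_distrib]
      refine Finset.sum_congr rfl fun e _ => ?_
      by_cases he : (f e).1 = a e
      · simp [he]
      · simp only [(hmem e).resolve_left he]
        rw [if_neg (fun hh => he (((hmem e).resolve_left he).trans hh)), add_comm]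
    rw [hsrc w] at key
    show (Finset.univ.filter fun e => (if (f e).1 = a e then b e else a e) = w).card = k
    omega

/-- The edges of a `k`-regular bipartite multigraph can be coloured with `k` colours such that
edges of the same colour have distinct ends on both sides. -/
theorem exists_edge_colouring_of_regular {E W : Type*} [Fintype W] [DecidableEq E]
    [DecidableEq W] (src tgt : E → W) (k : ℕ) (S : Finset E)
    (hs : ∀ w, (S.filter fun e => src e = w).card = k)
    (ht : ∀ w, (S.filter fun e => tgt e = w).card = k) :
    ∃ c : E → ℕ, (∀ e ∈ S, c e < k) ∧ ∀ e ∈ S, ∀ e' ∈ S, c e = c e' →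
      (src e = src e' ∨ tgt e = tgt e') → e = e' := by
  induction k generalizing S with
  | zero =>
    have hS : ∀ e, e ∉ S := fun e he => by
      have := Finset.card_eq_zero.1 (hs (src e))
      exact Finset.notMem_empty e (this ▸ Finset.mem_filter.2 ⟨he, rfl⟩)
    exact ⟨fun _ => 0, fun e he => (hS e he).elim, fun e he => (hS e he).elim⟩
  | succ k ih =>
    -- Regularity gives Hall's condition: the `(k + 1) * A.card` edges leaving `A` all end in its
    -- neighbourhood, which absorbs at most `k + 1` per vertex.
    have hall : ∀ A : Finset W, A.card ≤
        (A.biUnion fun w => (S.filter fun e => src e = w).image tgt).card := by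
      intro A
      set N := A.biUnion fun w => (S.filter fun e => src e = w).image tgt with hN
      set T := S.filter fun e => src e ∈ A with hT
      have h1 : T.card = ∑ w ∈ A, (T.filter fun e => src e = w).card :=
        Finset.card_eq_sum_card_fiberwise fun e he => (Finset.mem_filter.1 he).2
      have h2 : T.card = ∑ w ∈ N, (T.filter fun e => tgt e = w).card :=
        Finset.card_eq_sum_card_fiberwise fun e he => by
          have := Finset.mem_filter.1 he
          exact Finset.mem_biUnion.2 ⟨src e, this.2, Finset.mem_image.2
            ⟨e, Finset.mem_filter.2 ⟨this.1, rfl⟩, rfl⟩⟩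
      have h3 : T.card = A.card * (k + 1) := by
        rw [h1, ← smul_eq_mul]
        refine Finset.sum_eq_card_nsmul fun w hw => ?_
        rw [← hs w]
        congr 1
        ext e
        simp only [hT, Finset.mem_filter]
        constructor
        · rintro ⟨⟨h, -⟩, h'⟩
          exact ⟨h, h'⟩
        · rintro ⟨h, rfl⟩
          exact ⟨⟨h, hw⟩, rfl⟩
      have h4 : T.card ≤ N.card * (k + 1) := by
        rw [h2, ← smul_eq_mul]
        refine Finset.sum_le_card_nsmul _ _ _ fun w _ => ?_
        rw [← ht w]
        exact Finset.card_le_card (Finset.filter_subset_filter _ (Finset.filter_subset _ _))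
      exact Nat.le_of_mul_le_mul_right (h3 ▸ h4) k.succ_pos
    obtain ⟨f, hf, hfm⟩ := (Finset.all_card_le_biUnion_card_iff_exists_injective _).1 hall
    have hex : ∀ w, ∃ e ∈ S, src e = w ∧ tgt e = f w := fun w => by
      obtain ⟨e, he, h⟩ := Finset.mem_image.1 (hfm w)
      exact ⟨e, (Finset.mem_filter.1 he).1, (Finset.mem_filter.1 he).2, h⟩
    choose m hmS hmsrc hmtgt using hex
    -- The matching is perfect, so deleting it lowers the degree by one on the target side too.
    have hfs : Function.Surjective f := Finite.surjective_of_injective hf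
    set S' := S.filter fun e => m (src e) ≠ e with hS'
    have hs' : ∀ w, (S'.filter fun e => src e = w).card = k := by
      intro w
      have : S'.filter (fun e => src e = w) = (S.filter fun e => src e = w).erase (m w) := by
        ext e
        simp only [hS', Finset.mem_filter, Finset.mem_erase]
        constructor
        · rintro ⟨⟨h, h'⟩, rfl⟩
          exact ⟨h'.symm, h, rfl⟩
        · rintro ⟨h, h', rfl⟩
          exact ⟨⟨h', Ne.symm h⟩, rfl⟩
      rw [this, Finset.card_erase_of_mem (Finset.mem_filter.2 ⟨hmS w, hmsrc w⟩), hs w]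
      rfl
    have ht' : ∀ w, (S'.filter fun e => tgt e = w).card = k := by
      intro w
      obtain ⟨u, rfl⟩ := hfs w
      have : S'.filter (fun e => tgt e = f u) = (S.filter fun e => tgt e = f u).erase (m u) := by
        ext e
        simp only [hS', Finset.mem_filter, Finset.mem_erase]
        constructor
        · rintro ⟨⟨h, h'⟩, h''⟩
          refine ⟨?_, h, h''⟩
          rintro rfl
          exact h' (by rw [hmsrc])
        · rintro ⟨h, h', h''⟩
          refine ⟨⟨h', fun h3 => h ?_⟩, h''⟩
          have : f (src e) = f u := by rw [← hmtgt, h3, h'']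
          rw [← h3, hf this]
      rw [this, Finset.card_erase_of_mem (Finset.mem_filter.2 ⟨hmS u, hmtgt u⟩), ht]
      rfl
    obtain ⟨c, hc, hinj⟩ := ih S' hs' ht'
    have hmem : ∀ e ∈ S, m (src e) ≠ e → e ∈ S' := fun e he h => Finset.mem_filter.2 ⟨he, h⟩
    refine ⟨fun e => if m (src e) = e then k else c e, fun e he => ?_, fun e he e' he' hcc h => ?_⟩
    · by_cases h : m (src e) = e
      · simp [h]
      · simpa [h] using (hc e (hmem e he h)).trans k.lt_succ_self
    · by_cases h1 : m (src e) = e <;> by_cases h2 : m (src e') = e'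
      · rcases h with h | h
        · rw [← h1, ← h2, h]
        · rw [← h1, ← h2, hmtgt, hmtgt] at h
          rw [← h1, ← h2, hf h]
      · have := hc e' (hmem e' he' h2)
        simp only [h1, h2, if_true, if_false] at hcc
        omega
      · have := hc e (hmem e he h1)
        simp only [h1, h2, if_true, if_false] at hcc
        omega
      · simp only [h1, h2, if_false] at hcc
        exact hinj e (hmem e he h1) e' (hmem e' he' h2) hcc h

/-! ### Numbering along cycles -/

/-- The vertices permuted by `σ` can be numbered along its cycles, so that no two edges of its
cycle graph interleave. -/
theorem Equiv.Perm.exists_noninterleaving_labelling {V : Type*} [Fintype V] (σ : Equiv.Perm V) :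
    ∃ L : V → ℕ, Function.Injective L ∧ ∀ a b c d : V,
      (b = σ a ∨ a = σ b) → (d = σ c ∨ c = σ d) → L a < L c → L c < L b → L b < L d → False := by
  classical
  let r : V → V := fun v => (Quotient.mk (Equiv.Perm.SameCycle.setoid σ) v).out
  have hr : ∀ v, σ.SameCycle (r v) v := fun v =>
    Quotient.exact (s := Equiv.Perm.SameCycle.setoid σ) (Quotient.out_eq _)
  have hrσ : ∀ v, r (σ v) = r v := fun v => by
    have : (Quotient.mk (Equiv.Perm.SameCycle.setoid σ) (σ v)) =
        Quotient.mk (Equiv.Perm.SameCycle.setoid σ) v :=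
      Quotient.sound (Equiv.Perm.sameCycle_apply_left.2 (Equiv.Perm.SameCycle.refl σ v))
    simp only [r, this]
  have hex : ∀ v, ∃ n : ℕ, (σ ^ n) (r v) = v := fun v => by
    obtain ⟨i, -, h⟩ := (hr v).exists_pow_eq'
    exact ⟨i, h⟩
  let e : V → ℕ := fun v => Nat.find (hex v)
  have he : ∀ v, (σ ^ e v) (r v) = v := fun v => Nat.find_spec (hex v)
  -- `e` is the distance along the cycle from its representative; it resets only on returning there.
  have hstep : ∀ v, e (σ v) = 0 ∨ e (σ v) = e v + 1 := by
    intro v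
    rcases hm : e (σ v) with _ | m
    · exact Or.inl rfl
    · right
      have h1 : e (σ v) ≤ e v + 1 := Nat.find_min' _ (by
        rw [hrσ, pow_succ', Equiv.Perm.mul_apply, he v])
      have h2 : e v ≤ m := Nat.find_min' _ (by
        have := he (σ v)
        rw [hm, hrσ, pow_succ', Equiv.Perm.mul_apply] at this
        exact σ.injective this)
      omega
  obtain ⟨B, hB⟩ : ∃ B, ∀ v, e v < B :=
    ⟨Finset.univ.sup e + 1, fun v => Nat.lt_succ_of_le (Finset.le_sup (Finset.mem_univ v))⟩
  let idx : V → ℕ := fun v => (Fintype.equivFin V (r v) : ℕ)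
  have hidx : ∀ v w, idx v = idx w → r v = r w := fun v w h =>
    (Fintype.equivFin V).injective (Fin.ext h)
  have hlt : ∀ v w, B * idx v + e v < B * idx w + e w → idx v ≤ idx w := by
    intro v w h
    by_contra! hc
    have := Nat.mul_le_mul_left B (Nat.succ_le_of_lt hc)
    have := hB w
    rw [Nat.mul_succ] at *
    omega
  have hedge : ∀ a b, (b = σ a ∨ a = σ b) → idx a = idx b ∧
      (e b = 0 ∨ e b = e a + 1 ∨ e a = 0 ∨ e a = e b + 1) := by
    rintro a b (rfl | rfl)
    · exact ⟨by simp only [idx, hrσ], by have := hstep a; tauto⟩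
    · exact ⟨by simp only [idx, hrσ], by have := hstep b; tauto⟩
  -- Each cycle gets its own block of `B` labels. Interleaving edges lie in one block; as neither
  -- joins consecutive positions, both left ends would be at position 0.
  refine ⟨fun v => B * idx v + e v, fun v w h => ?_, fun a b c d hab hcd h1 h2 h3 => ?_⟩
  · have hi : idx v = idx w := by
      have hv := hB v
      have hw := hB w
      have hBpos : 0 < B := by omega
      have := congrArg (· / B) h
      simpa [Nat.mul_add_div hBpos, Nat.div_eq_of_lt hv, Nat.div_eq_of_lt hw] using this
    have hee : e v = e w := by
      simp only [hi] at h
      omega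
    rw [← he v, ← he w, hee, hidx v w hi]
  · obtain ⟨i1, j1⟩ := hedge a b hab
    obtain ⟨i2, j2⟩ := hedge c d hcd
    have k1 := hlt a c h1
    have k2 := hlt c b h2
    have i3 : idx c = idx a := by omega
    simp only [← i2, ← i1, i3] at h1 h2 h3
    omega

/-! ### Moving points by plane homeomorphisms -/

/-- The vertical shear along the graph of a continuous function. -/
def verticalShear (f : C(ℝ, ℝ)) : ℝ × ℝ ≃ₜ ℝ × ℝ where
  toFun p := (p.1, p.2 + f p.1)
  invFun p := (p.1, p.2 - f p.1)
  left_inv p := by simp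
  right_inv p := by simp
  continuous_toFun := by fun_prop
  continuous_invFun := by fun_prop

theorem verticalShear_apply (f : C(ℝ, ℝ)) (p : ℝ × ℝ) :
    verticalShear f p = (p.1, p.2 + f p.1) := rfl

/-- Points with distinct first coordinates can be moved vertically to any heights. -/
theorem exists_homeomorph_move_vertically {V : Type*} [Fintype V] (x y z : V → ℝ)
    (hx : Function.Injective x) :
    ∃ h : ℝ × ℝ ≃ₜ ℝ × ℝ, ∀ v, h (x v, y v) = (x v, z v) := by
  classical
  let P := Lagrange.interpolate Finset.univ x fun v => z v - y v
  refine ⟨verticalShear ⟨fun t => P.eval t, P.continuous⟩, fun v => ?_⟩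
  have : P.eval (x v) = z v - y v :=
    Lagrange.eval_interpolate_at_node _ hx.injOn (Finset.mem_univ v)
  simp [verticalShear_apply, this]

/-- Two distinct points collide for at most one slope, so only finitely many slopes are bad. Pairs
with equal first coordinates merely add the value 0, by division by zero. -/
theorem exists_injective_linear_combination {V : Type*} [Fintype V] (p : V → ℝ × ℝ)
    (hp : Function.Injective p) : ∃ s : ℝ, Function.Injective fun v => (p v).2 + s * (p v).1 := by
  classical
  let bad : Set ℝ :=
    Set.range fun q : V × V => ((p q.2).2 - (p q.1).2) / ((p q.1).1 - (p q.2).1)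
  obtain ⟨s, hs⟩ := (Set.finite_range _ : bad.Finite).exists_notMem
  refine ⟨s, fun v w h => hp ?_⟩
  simp only at h
  by_cases h1 : (p v).1 = (p w).1
  · refine Prod.ext h1 ?_
    rw [h1] at h
    linarith
  · refine (hs ⟨(v, w), ?_⟩).elim
    have : (p v).1 - (p w).1 ≠ 0 := sub_ne_zero.2 h1
    simp only
    field_simp
    linarith

/-- Any finitely many distinct points of the plane can be moved by a homeomorphism to any
distinct points of the first axis. -/
theorem exists_homeomorph_to_axis {V : Type*} [Fintype V] (p : V → ℝ × ℝ)
    (hp : Function.Injective p) (x : V → ℝ) (hx : Function.Injective x) :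
    ∃ h : ℝ × ℝ ≃ₜ ℝ × ℝ, ∀ v, h (p v) = (x v, 0) := by
  obtain ⟨s, hs⟩ := exists_injective_linear_combination p hp
  let h₁ := verticalShear ⟨fun t => s * t, by fun_prop⟩
  obtain ⟨h₂, hh₂⟩ := exists_homeomorph_move_vertically
    (fun v => (p v).2 + s * (p v).1) (fun v => (p v).1) x hs
  obtain ⟨h₃, hh₃⟩ := exists_homeomorph_move_vertically x
    (fun v => (p v).2 + s * (p v).1) (fun _ => 0) hx
  -- Shear to make heights distinct, move horizontally (a vertical move conjugated by the swap) to
  -- the abscissae `x`, then drop to the axis.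
  refine ⟨h₁.trans ((Homeomorph.prodComm ℝ ℝ).trans (h₂.trans
    ((Homeomorph.prodComm ℝ ℝ).trans h₃))), fun v => ?_⟩
  have e1 : h₁ (p v) = ((p v).1, (p v).2 + s * (p v).1) := rfl
  simp [e1, hh₂ v, hh₃ v]

/-! ### Drawing with parabolic arcs -/

/-- Parabolic arcs over two distinct intervals of the first axis that do not interleave meet only
at common endpoints. -/
theorem parabolic_arcs_meet {a b c d x : ℝ} (hac : a ≤ c) (hax : a ≤ x) (hxb : x ≤ b)
    (hcx : c ≤ x) (hxd : x ≤ d) (hcd : c < d) (hne : ¬ (a = c ∧ b = d))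
    (hcross : ¬ (a < c ∧ c < b ∧ b < d)) (h : (x - a) * (b - x) = (x - c) * (d - x)) :
    (x = a ∨ x = b) ∧ (x = c ∨ x = d) := by
  rcases le_or_gt d b with hdb | hbd
  · rcases hcx.eq_or_lt with rfl | hcx
    · rw [sub_self, zero_mul, mul_eq_zero] at h
      exact ⟨h.imp (fun h => by linarith) (fun h => by linarith), Or.inl rfl⟩
    · rcases hxd.eq_or_lt with rfl | hxd
      · rw [sub_self, mul_zero, mul_eq_zero] at h
        exact ⟨h.imp (fun h => by linarith) (fun h => by linarith), Or.inr rfl⟩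
      -- For nested intervals the height difference is a sum of two nonnegative terms; if it
      -- vanishes strictly inside `(c, d)`, the intervals coincide.
      · have h1 : 0 ≤ (c - a) * (b - x) := mul_nonneg (by linarith) (by linarith)
        have h2 : 0 ≤ (x - c) * (b - d) := mul_nonneg (by linarith) (by linarith)
        have h3 : (c - a) * (b - x) + (x - c) * (b - d) = 0 := by linear_combination h
        have h4 : (c - a) * (b - x) = 0 := by linarith
        have h5 : (x - c) * (b - d) = 0 := by linarith
        refine (hne ⟨?_, ?_⟩).elim
        · rcases mul_eq_zero.1 h4 with h | h <;> linarith
        · rcases mul_eq_zero.1 h5 with h | h <;> linarith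
  · rcases hac.eq_or_lt with rfl | hac
    · have h1 : (x - a) * (d - b) = 0 := by linear_combination -h
      have h2 : x = a := by rcases mul_eq_zero.1 h1 with h | h <;> linarith
      exact ⟨Or.inl h2, Or.inl h2⟩
    · have hbc : b ≤ c := not_lt.1 fun hcb => hcross ⟨hac, hcb, hbd⟩
      exact ⟨Or.inr (by linarith), Or.inl (by linarith)⟩

/-- The parabolic arc from `a` to `b` over the first axis. -/
def parabolicArc (a b : ℝ) : C(unitInterval, ℝ × ℝ) where
  toFun t := (a + t * (b - a), (a + t * (b - a) - a) * (b - (a + t * (b - a))))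
  continuous_toFun := by fun_prop

theorem parabolicArc_zero (a b : ℝ) : parabolicArc a b 0 = (a, 0) := by
  simp [parabolicArc]

theorem parabolicArc_one (a b : ℝ) : parabolicArc a b 1 = (b, 0) := by
  simp [parabolicArc]

theorem parabolicArc_injective {a b : ℝ} (h : a < b) : Function.Injective (parabolicArc a b) := by
  intro s t hst
  have h1 : a + (s : ℝ) * (b - a) = a + (t : ℝ) * (b - a) := congrArg Prod.fst hst
  exact Subtype.ext (mul_right_cancel₀ (sub_ne_zero.2 h.ne') (add_left_cancel h1))

theorem exists_parabolicArc_eq {a b : ℝ} (h : a < b) (t : unitInterval) :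
    ∃ x, a ≤ x ∧ x ≤ b ∧ parabolicArc a b t = (x, (x - a) * (b - x)) := by
  have hba : 0 ≤ b - a := by linarith
  have h0 := mul_nonneg t.2.1 hba
  have h1 := mul_le_mul_of_nonneg_right t.2.2 hba
  exact ⟨a + t * (b - a), by linarith, by linarith, rfl⟩

/-- A graph with a numbering of its vertices in which no two edges interleave has a crossing-free
drawing for every placement of its vertices at distinct points. -/
theorem nonempty_planeDrawing_of_noninterleaving {V : Type*} [Fintype V] (G : SimpleGraph V)
    (pos : V → ℝ × ℝ) (hpos : Function.Injective pos) (L : V → ℕ) (hL : Function.Injective L)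
    (hcross : ∀ a b c d : V, G.Adj a b → G.Adj c d → L a < L c → L c < L b → L b < L d → False) :
    Nonempty (PlaneDrawing G pos) := by
  have hLR : Function.Injective fun v => (L v : ℝ) := Nat.cast_injective.comp hL
  obtain ⟨h, hh⟩ := exists_homeomorph_to_axis pos hpos _ hLR
  have hends : ∀ e : G.edgeSet, ∃ a b : V, (e : Sym2 V) = s(a, b) ∧ G.Adj a b ∧ L a < L b := by
    rintro ⟨e, he⟩
    induction e with
    | _ a b =>
      have hab : G.Adj a b := he
      rcases lt_or_gt_of_ne (hL.ne hab.ne) with hl | hl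
      · exact ⟨a, b, rfl, hab, hl⟩
      · exact ⟨b, a, Sym2.eq_swap, hab.symm, hl⟩
  choose a b hab hadj hlt using hends
  have hltR : ∀ e, (L (a e) : ℝ) < L (b e) := fun e => Nat.cast_lt.2 (hlt e)
  have hsymm : ∀ v, h.symm ((L v : ℝ), 0) = pos v := fun v => by rw [← hh v, h.symm_apply_apply]
  have meet : ∀ e f : G.edgeSet, e ≠ f → L (a e) ≤ L (a f) → ∀ s t : unitInterval,
      parabolicArc (L (a e)) (L (b e)) s = parabolicArc (L (a f)) (L (b f)) t →
      ∃ v : V, v ∈ (e : Sym2 V) ∧ v ∈ (f : Sym2 V) ∧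
        parabolicArc (L (a e)) (L (b e)) s = ((L v : ℝ), 0) := by
    intro e f hef hle s t hst
    obtain ⟨x, hx1, hx2, hx⟩ := exists_parabolicArc_eq (hltR e) s
    obtain ⟨y, hy1, hy2, hy⟩ := exists_parabolicArc_eq (hltR f) t
    rw [hx, hy, Prod.mk.injEq] at hst
    obtain ⟨rfl, hst⟩ := hst
    have key := parabolic_arcs_meet (Nat.cast_le.2 hle) hx1 hx2 hy1 hy2 (hltR f)
      (fun hc => hef (Subtype.ext (by rw [hab e, hab f, hLR hc.1, hLR hc.2])))
      (fun hc => hcross _ _ _ _ (hadj e) (hadj f) (Nat.cast_lt.1 hc.1) (Nat.cast_lt.1 hc.2.1)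
        (Nat.cast_lt.1 hc.2.2)) hst
    obtain ⟨v, hv, rfl⟩ : ∃ v, v ∈ (e : Sym2 V) ∧ x = L v := by
      rcases key.1 with k | k
      · exact ⟨a e, by rw [hab e]; simp, k⟩
      · exact ⟨b e, by rw [hab e]; simp, k⟩
    refine ⟨v, hv, ?_, ?_⟩
    · rcases key.2 with k | k
      · rw [hab f, hLR k]; simp
      · rw [hab f, hLR k]; simp
    · rw [hx]
      rcases key.1 with k | k <;> simp [k]
  refine ⟨⟨fun e => (h.symm : C(ℝ × ℝ, ℝ × ℝ)).comp (parabolicArc (L (a e)) (L (b e))), hpos,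
    fun e => h.symm.injective.comp (parabolicArc_injective (hltR e)), fun e => ?_,
    fun e t v hv => ?_, fun e f hef s t hst => ?_⟩⟩
  · simp only [ContinuousMap.comp_apply, parabolicArc_zero, parabolicArc_one]
    rw [hab e, Sym2.map_mk]
    exact congrArg₂ (fun x y => s(x, y)) (hsymm _) (hsymm _)
  · have h1 : parabolicArc (L (a e)) (L (b e)) t = ((L v : ℝ), 0) :=
      h.symm.injective (hv.trans (hsymm v).symm)
    obtain ⟨x, hx1, hx2, hx⟩ := exists_parabolicArc_eq (hltR e) t
    rw [hx, Prod.mk.injEq] at h1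
    obtain ⟨rfl, h1⟩ := h1
    rw [hab e, Sym2.mem_iff]
    rcases mul_eq_zero.1 h1 with k | k
    · exact Or.inl (hLR (sub_eq_zero.1 k))
    · exact Or.inr (hLR (sub_eq_zero.1 k).symm)
  · have hst' : parabolicArc (L (a e)) (L (b e)) s = parabolicArc (L (a f)) (L (b f)) t :=
      h.symm.injective hst
    rcases le_total (L (a e)) (L (a f)) with hle | hle
    · obtain ⟨v, h1, h2, h3⟩ := meet e f hef hle s t hst'
      exact ⟨v, h1, h2, (congrArg h.symm h3).trans (hsymm v)⟩
    · obtain ⟨v, h1, h2, h3⟩ := meet f e hef.symm hle t s hst'.symm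
      exact ⟨v, h2, h1, (congrArg h.symm (hst'.trans h3)).trans (hsymm v)⟩

/-- A graph whose edges can be oriented along a partial injection of the vertices has a
crossing-free drawing for every placement of its vertices at distinct points. -/
theorem nonempty_planeDrawing_of_partial_injection {V : Type*} [Fintype V] (G : SimpleGraph V)
    (R : V → V → Prop) (hR : ∀ a b, G.Adj a b → R a b ∨ R b a)
    (hr : ∀ a b c, R a b → R a c → b = c) (hl : ∀ a b c, R a c → R b c → a = b)
    (pos : V → ℝ × ℝ) (hpos : Function.Injective pos) : Nonempty (PlaneDrawing G pos) := by
  classical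
  let f : V → V := fun v => if h : ∃ w, R v w then h.choose else v
  have hf : ∀ v w, R v w → f v = w := fun v w hvw => by
    have hex : ∃ w, R v w := ⟨w, hvw⟩
    simp only [f, dif_pos hex]
    exact hr _ _ _ hex.choose_spec hvw
  -- A partial injection of a finite set extends to a permutation, closing paths into cycles; the
  -- default value of `f` plays no role.
  obtain ⟨g, hg⟩ := Set.MapsTo.exists_equiv_extend_of_card_eq (t := (Finset.univ : Finset V))
    (Finset.card_univ).symm (s := {v | ∃ w, R v w}) (f := f) (fun _ _ => by simp)
    (by
      rintro v ⟨w, hv⟩ v' ⟨w', hv'⟩ h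
      rw [hf v w hv, hf v' w' hv'] at h
      exact hl _ _ _ hv (h ▸ hv'))
  let σ : Equiv.Perm V := g.trans (Equiv.subtypeUnivEquiv fun v => Finset.mem_univ v)
  have hσ : ∀ v w, R v w → w = σ v := fun v w h => ((hg v ⟨w, h⟩).trans (hf v w h)).symm
  obtain ⟨L, hL, hcross⟩ := σ.exists_noninterleaving_labelling
  have hadj : ∀ a b, G.Adj a b → b = σ a ∨ a = σ b := fun a b h =>
    (hR a b h).imp (hσ a b) (hσ b a)
  exact nonempty_planeDrawing_of_noninterleaving G pos hpos L hL fun a b c d h1 h2 =>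
    hcross a b c d (hadj a b h1) (hadj c d h2)

/-! ### Splitting a graph into layers -/

/-- In a graph with degrees at most `2 * k` the edges can be oriented and coloured with `k` colours
such that every vertex has at most one incoming and one outgoing edge of each colour. -/
theorem SimpleGraph.exists_oriented_colouring {V : Type*} [Fintype V] (G : SimpleGraph V)
    [DecidableRel G.Adj] (k : ℕ) (hdeg : ∀ v, G.degree v ≤ 2 * k) :
    ∃ (c : G.edgeSet → Fin k) (src tgt : G.edgeSet → V),
      (∀ e : G.edgeSet, (e : Sym2 V) = s(src e, tgt e)) ∧
      (∀ e f, c e = c f → src e = src f → e = f) ∧ ∀ e f, c e = c f → tgt e = tgt f → e = f := by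
  classical
  -- Padding to a `2 * k`-regular multigraph: two copies of `G`, with the missing degree at `v`
  -- filled by parallel edges between its two copies. The `false` copy is kept at the end.
  let E := (G.edgeSet × Bool) ⊕ (Σ v : V, Fin (2 * k - G.degree v))
  let a : E → V × Bool := Sum.elim (fun p => ((p.1 : Sym2 V).out.1, p.2)) fun p => (p.1, false)
  let b : E → V × Bool := Sum.elim (fun p => ((p.1 : Sym2 V).out.2, p.2)) fun p => (p.1, true)
  have hout : ∀ e : Sym2 V, e = s(e.out.1, e.out.2) := fun e => (Quot.out_eq e).symm
  have hG : ∀ v, (Finset.univ.filter fun e : G.edgeSet => (e : Sym2 V).out.1 = v).card +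
      (Finset.univ.filter fun e : G.edgeSet => (e : Sym2 V).out.2 = v).card = G.degree v := by
    intro v
    rw [← Finset.card_union_of_disjoint, ← G.card_incidenceFinset_eq_degree v]
    · refine Finset.card_bij (fun e _ => (e : Sym2 V)) ?_ (fun _ _ _ _ h => Subtype.ext h) ?_
      · intro e he
        rw [SimpleGraph.mem_incidenceFinset]
        refine ⟨e.2, ?_⟩
        rw [hout (e : Sym2 V), Sym2.mem_iff]
        simpa [eq_comm] using he
      · intro e he
        rw [SimpleGraph.mem_incidenceFinset] at he
        obtain ⟨h1, h2⟩ := he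
        rw [hout e, Sym2.mem_iff] at h2
        exact ⟨⟨e, h1⟩, by simpa [eq_comm] using h2, rfl⟩
    · rw [Finset.disjoint_filter]
      rintro ⟨e, he⟩ - h1 h2
      have h3 : G.Adj e.out.1 e.out.2 := by
        rw [← SimpleGraph.mem_edgeSet, ← hout e]
        exact he
      exact h3.ne (h1.trans h2.symm)
  have hfib : ∀ (g : G.edgeSet → V) (v : V) (β : Bool),
      (∑ p : G.edgeSet × Bool, if (g p.1, p.2) = (v, β) then 1 else 0) =
        (Finset.univ.filter fun e => g e = v).card := by
    intro g v β
    rw [Fintype.sum_prod_type, Finset.card_filter]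
    refine Finset.sum_congr rfl fun e _ => ?_
    by_cases h : g e = v <;> simp [h]
  have hpad : ∀ (v : V) (β γ : Bool),
      (∑ p : Σ v : V, Fin (2 * k - G.degree v), if (p.1, γ) = (v, β) then 1 else 0) =
        if γ = β then 2 * k - G.degree v else 0 := by
    intro v β γ
    rw [Fintype.sum_sigma]
    by_cases h : γ = β <;> simp [h]
  have hreg : ∀ w, (Finset.univ.filter fun e => a e = w).card +
      (Finset.univ.filter fun e => b e = w).card = 2 * k := by
    rintro ⟨v, β⟩
    rw [Finset.card_filter, Finset.card_filter, Fintype.sum_sum_type, Fintype.sum_sum_type]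
    have h1 := hfib (fun e => (e : Sym2 V).out.1) v β
    have h2 := hfib (fun e => (e : Sym2 V).out.2) v β
    refine (congrArg₂ (· + ·) (congrArg₂ (· + ·) h1 (hpad v β false))
      (congrArg₂ (· + ·) h2 (hpad v β true))).trans ?_
    have := hG v
    have := hdeg v
    cases β <;> simp <;> omega
  obtain ⟨src, tgt, hst, hs, ht⟩ := exists_balanced_orientation k a b hreg
  obtain ⟨c, hc, hinj⟩ := exists_edge_colouring_of_regular src tgt k Finset.univ hs ht
  have hcopy : ∀ e : G.edgeSet,
      (src (Sum.inl (e, false))).2 = false ∧ (tgt (Sum.inl (e, false))).2 = false := by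
    intro e
    rcases hst (Sum.inl (e, false)) with ⟨h1, h2⟩ | ⟨h1, h2⟩ <;> rw [h1, h2] <;> exact ⟨rfl, rfl⟩
  refine ⟨fun e => ⟨c (Sum.inl (e, false)), hc _ (Finset.mem_univ _)⟩,
    fun e => (src (Sum.inl (e, false))).1, fun e => (tgt (Sum.inl (e, false))).1,
    fun e => ?_, fun e f hcc h => ?_, fun e f hcc h => ?_⟩
  · rcases hst (Sum.inl (e, false)) with ⟨h1, h2⟩ | ⟨h1, h2⟩
    · simp only [h1, h2]
      exact hout e
    · simp only [h1, h2]
      exact (hout e).trans Sym2.eq_swap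
  · have := hinj _ (Finset.mem_univ _) _ (Finset.mem_univ _) (Fin.mk.inj_iff.1 hcc)
      (Or.inl (Prod.ext h ((hcopy e).1.trans (hcopy f).1.symm)))
    exact congrArg Prod.fst (Sum.inl_injective this)
  · have := hinj _ (Finset.mem_univ _) _ (Finset.mem_univ _) (Fin.mk.inj_iff.1 hcc)
      (Or.inr (Prod.ext h ((hcopy e).2.trans (hcopy f).2.symm)))
    exact congrArg Prod.fst (Sum.inl_injective this)

/-- The edges of a graph with degrees at most `2 * k` can be partitioned into `k` layers each of
which has a crossing-free drawing for every placement of the vertices at distinct points. -/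
theorem SimpleGraph.exists_edgePartition_drawable {V : Type*} [Fintype V] (G : SimpleGraph V)
    [DecidableRel G.Adj] (k : ℕ) (hdeg : ∀ v, G.degree v ≤ 2 * k) :
    ∃ layer : Fin k → SimpleGraph V, IsEdgePartition G layer ∧
      ∀ pos : V → ℝ × ℝ, Function.Injective pos → ∀ i, Nonempty (PlaneDrawing (layer i) pos) := by
  obtain ⟨c, src, tgt, hends, hsrc, htgt⟩ := G.exists_oriented_colouring k hdeg
  let layer : Fin k → SimpleGraph V := fun i =>
    { Adj := fun a b => ∃ h : G.Adj a b, c ⟨s(a, b), h⟩ = i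
      symm := ⟨by
        rintro a b ⟨h, hc⟩
        refine ⟨h.symm, ?_⟩
        rw [← hc]
        exact congrArg c (Subtype.ext Sym2.eq_swap)⟩
      loopless := ⟨fun a h => G.loopless.irrefl a h.1⟩ }
  refine ⟨layer, ⟨?_, fun i j hij => ?_⟩, fun pos hpos i => ?_⟩
  · ext a b
    rw [SimpleGraph.iSup_adj]
    exact ⟨fun ⟨_, h, _⟩ => h, fun h => ⟨c ⟨s(a, b), h⟩, h, rfl⟩⟩
  · beta_reduce
    rw [← SimpleGraph.disjoint_edgeSet, Set.disjoint_left]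
    intro e
    induction e with
    | _ a b =>
      rintro ⟨_, h1⟩ ⟨_, h2⟩
      exact hij (h1.symm.trans h2)
  · refine nonempty_planeDrawing_of_partial_injection (layer i)
      (fun a b => ∃ e, c e = i ∧ src e = a ∧ tgt e = b) ?_ ?_ ?_ pos hpos
    · rintro a b ⟨h, hc⟩
      rcases Sym2.eq_iff.1 (hends ⟨s(a, b), h⟩) with ⟨h1, h2⟩ | ⟨h1, h2⟩
      · exact Or.inl ⟨_, hc, h1.symm, h2.symm⟩
      · exact Or.inr ⟨_, hc, h2.symm, h1.symm⟩
    · rintro _ _ _ ⟨e, he, h1, rfl⟩ ⟨f, hf, h2, rfl⟩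
      rw [hsrc e f (he.trans hf.symm) (h1.trans h2.symm)]
    · rintro _ _ _ ⟨e, he, rfl, h1⟩ ⟨f, hf, rfl, h2⟩
      rw [htgt e f (he.trans hf.symm) (h1.trans h2.symm)]

theorem gridPoint_injective : Function.Injective gridPoint := fun _ _ h =>
  Prod.ext (Int.cast_injective (congrArg Prod.fst h)) (Int.cast_injective (congrArg Prod.snd h))

theorem mainTheorem2 {V : Type*} [Fintype V] (C : QuantumCircuit V)
    [DecidableRel (QuantumCircuit.connectivityGraph C).Adj] (δ : ℕ)
    (hδ : (QuantumCircuit.connectivityGraph C).maxDegree ≤ δ) :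
    (QuantumCircuit.connectivityGraph C).thickness ≤ ((⌈(δ : ℚ) / 2⌉₊ : ℕ) : ℕ∞) ∧
      (∃ L : PlanarLayout V ⌈(δ : ℚ) / 2⌉₊, L.Implements C) ∧
      ∀ position : V ↪ ℤ × ℤ, ∃ L : PlanarLayout V ⌈(δ : ℚ) / 2⌉₊,
        L.position = position ∧
          L.connections = QuantumCircuit.connectivityGraph C ∧ L.Implements C := by
  have hk : δ ≤ 2 * ⌈(δ : ℚ) / 2⌉₊ := by
    have h := Nat.le_ceil ((δ : ℚ) / 2)
    have : (δ : ℚ) ≤ 2 * ⌈(δ : ℚ) / 2⌉₊ := by linarith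
    exact_mod_cast this
  obtain ⟨layer, hpart, hdraw⟩ := (QuantumCircuit.connectivityGraph C).exists_edgePartition_drawable
    ⌈(δ : ℚ) / 2⌉₊ fun v => (((QuantumCircuit.connectivityGraph C).degree_le_maxDegree v).trans
      hδ).trans hk
  have hall : ∀ position : V ↪ ℤ × ℤ, ∃ L : PlanarLayout V ⌈(δ : ℚ) / 2⌉₊,
      L.position = position ∧
        L.connections = QuantumCircuit.connectivityGraph C ∧ L.Implements C := by
    intro position
    refine ⟨⟨position, layer, hpart.2, fun i =>
      (hdraw _ (gridPoint_injective.comp position.injective) i).some⟩, rfl, hpart.1, ?_⟩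
    intro o ho a b hab
    have h : (⨆ i, layer i).Adj a b := by
      rw [hpart.1]
      exact ⟨o, ho, hab⟩
    exact SimpleGraph.iSup_adj.1 h
  let position : V ↪ ℤ × ℤ :=
    ⟨fun v => (((Fintype.equivFin V v : ℕ) : ℤ), 0), fun v w h =>
      (Fintype.equivFin V).injective (Fin.ext (Int.ofNat_injective (congrArg Prod.fst h)))⟩
  refine ⟨sInf_le ⟨_, layer, rfl, hpart, fun i => ⟨_,
    hdraw _ (gridPoint_injective.comp position.injective) i⟩⟩, ?_, hall⟩
  obtain ⟨L, -, -, hL⟩ := hall position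
  exact ⟨L, hL⟩
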